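/- For $(k_1,\dots,k_n)\in\mathbb N^n$ let $M=M(k_1,\dots,k_n)$ be the multiset containing each letter $j\in\{1,\dots,n\}$ exactly $k_j$ times, and let $M^*$ be the set of all permutations of $M$, i.e. of all words in which each letter $j\in\{1,\dots,n\}$ occurs exactly $k_j$ times and no other letter occurs. For $\sigma\in\mathfrak S_n$ put $\sigma\cdot M=M(k_{\sigma^{-1}(1)},\dots,k_{\sigma^{-1}(n)})$. A property $P$ of words is stable on $M$ if, for every $\sigma\in\mathfrak S_n$, the number of words in $M^*$ satisfying $P$ equals the number of words in $(\sigma\cdot M)^*$ satisfying $P$; $P$ is unstable if it is not stable on some multiset $M(k_1,\dots,k_n)$. Let $p=p_1p_2\cdots p_\ell$ be a consecutive pattern without repeated letters, that is, a word containing each of $1,\dots,\ell$ exactly once; an occurrence of $p$ in a word $w$ is a block $w_{a+1}w_{a+2}\cdots w_{a+\ell}$ of consecutive letters such that, for all $j,k$, $w_{a+j}<w_{a+k}$ if and only if $p_j<p_k$, and $w_{a+j}=w_{a+k}$ if and only if $p_j=p_k$. The pattern $p$ is unstable if there is a multiset $M(k_1,\dots,k_n)$ on which, for some $s\in\mathbb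 N$, the property "to have exactly $s$ occurrences of $p$" is not stable. An index $i$ with $2\le i\le\ell$ is extendable if there is a word $\pi$ of length $\ell+i-1$ over the positive integers such that the first $\ell$ letters and the last $\ell$ letters of $\pi$ each form an occurrence of $p$; the lexicographically smallest such $\pi$ is the extended permutation of $p$ at the index $i$. Proposition. Let $p$ be a consecutive pattern without repeated letters and let $i$ be its minimal extendable index. If the extended permutation of $p$ at the index $i$ contains a repeated letter, then the property "to have exactly two occurrences of $p$" is unstable, and hence the pattern $p$ is unstable. -/

import Mathlib

namespace MultisetPattern

/-! Words are lists of natural numbers; the letters of a permutation of a multiset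
are positive. Positions in a list are numbered from `0`. -/

/-- The multiset `M(k₁, …, kₙ)` in which the letter `j` (for `1 ≤ j ≤ n`) has multiplicity `k_j`;
the entry `k_j` is stored as `k ⟨j - 1, _⟩`. -/
def multisetOf {n : ℕ} (k : Fin n → ℕ) : Multiset ℕ :=
  ∑ j : Fin n, Multiset.replicate (k j) (j.val + 1)

/-- `M*`: the set of all permutations of `M(k₁, …, kₙ)`. -/
def multisetPerms {n : ℕ} (k : Fin n → ℕ) : Set (List ℕ) :=
  {w | (w : Multiset ℕ) = multisetOf k}

/-- `M*(P)`: the set of all permutations of `M(k₁, …, kₙ)` that satisfy `P`. -/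
def permsWith {n : ℕ} (P : List ℕ → Prop) (k : Fin n → ℕ) : Set (List ℕ) :=
  {w | w ∈ multisetPerms k ∧ P w}

/-- The action `σ · M(k₁, …, kₙ) = M(k_{σ⁻¹(1)}, …, k_{σ⁻¹(n)})` on multiplicity vectors. -/
def permuteMult {n : ℕ} (σ : Equiv.Perm (Fin n)) (k : Fin n → ℕ) : Fin n → ℕ :=
  fun j => k (σ⁻¹ j)

/-- `P` is stable on `M(k₁, …, kₙ)`: `|M*(P)| = |(σ · M)*(P)|` for every `σ ∈ 𝔖ₙ`. -/
def PropertyStableOn {n : ℕ} (P : List ℕ → Prop) (k : Fin n → ℕ) : Prop :=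
  ∀ σ : Equiv.Perm (Fin n), (permsWith P k).ncard = (permsWith P (permuteMult σ k)).ncard

/-- A property is unstable if it fails to be stable on some multiset. -/
def PropertyUnstable (P : List ℕ → Prop) : Prop :=
  ∃ (n : ℕ) (k : Fin n → ℕ), ¬ PropertyStableOn P k

/-- A pattern is a word over `{1, …, v}`, for some `v` at most its length,
in which every letter of `{1, …, v}` occurs. -/
def IsPattern (p : List ℕ) : Prop :=
  ∃ v, v ≤ p.length ∧ ∀ x, x ∈ p ↔ 1 ≤ x ∧ x ≤ v

/-- The factor of `w` of length `p.length` starting at position `a` exists and is an occurrence of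
the consecutive pattern `p`: its letters compare in the same way as those of `p`. (All positions
read by `getD` are within range.) -/
def OccursAt (p w : List ℕ) (a : ℕ) : Prop :=
  a + p.length ≤ w.length ∧
    ∀ j < p.length, ∀ k < p.length,
      (w.getD (a + j) 0 < w.getD (a + k) 0 ↔ p.getD j 0 < p.getD k 0) ∧
      (w.getD (a + j) 0 = w.getD (a + k) 0 ↔ p.getD j 0 = p.getD k 0)

instance (p w : List ℕ) : DecidablePred (OccursAt p w) := fun a => by
  unfold OccursAt; infer_instance

/-- The number of occurrences of the consecutive pattern `p` in `w`. -/
def occurrences (p w : List ℕ) : ℕ :=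
  ((Finset.range (w.length + 1)).filter (OccursAt p w)).card

/-- The property "to have (exactly) `s` occurrences of the consecutive pattern `p`". -/
def HasOccurrences (p : List ℕ) (s : ℕ) (w : List ℕ) : Prop :=
  occurrences p w = s

/-- The consecutive pattern `p` is stable on `M(k₁, …, kₙ)`. -/
def PatternStableOn {n : ℕ} (p : List ℕ) (k : Fin n → ℕ) : Prop :=
  ∀ s : ℕ, PropertyStableOn (HasOccurrences p s) k

/-- The consecutive pattern `p` is unstable: it fails to be stable on some multiset. -/
def PatternUnstable (p : List ℕ) : Prop :=
  ∃ (n : ℕ) (k : Fin n → ℕ), ¬ PatternStableOn p k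

/-- With `ℓ` the length of `p`: all words of positive integers of length `ℓ + i - 1` whose first
`ℓ` and whose last `ℓ` letters each form an occurrence of the consecutive pattern `p`.
Used for `2 ≤ i` only. -/
def extensions (p : List ℕ) (i : ℕ) : Set (List ℕ) :=
  {π | (∀ x ∈ π, 1 ≤ x) ∧ π.length = p.length + (i - 1) ∧ OccursAt p π 0 ∧ OccursAt p π (i - 1)}

/-- The index `i`, with `2 ≤ i ≤ ℓ`, is extendable. -/
def Extendable (p : List ℕ) (i : ℕ) : Prop :=
  2 ≤ i ∧ i ≤ p.length ∧ (extensions p i).Nonempty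

/-- `π` is the extended permutation of `p` at `i`: the smallest element of `extensions p i` in the
lexicographic order (the order of `List ℕ`). -/
def IsExtendedPermutation (p : List ℕ) (i : ℕ) (π : List ℕ) : Prop :=
  IsLeast (extensions p i) π

end MultisetPattern

/-! Let `ℓ` be the length of `p` and `d = i - 1` the least shift at which two occurrences can
overlap. A word of length `ℓ + d` has two occurrences exactly when its prefix and suffix are
occurrences. Its letter at position `d` then lies in both blocks, so `p` and `d` fix how it compares
with every other letter: it is simple (`count_getD_eq_one`), and the number `r` of letters below it
is fixed (`countP_lt_getD_eq`). In `π` let `c` be this letter and `t` a repeated one. Once the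
multiplicities of `t` and `c` are exchanged, no simple letter has `r` letters below it
(`countP_lt_ne_of_count_swap`), so the number of words with two occurrences drops from positive to
zero. -/

namespace MultisetPattern

/-! ### Letters below a given letter -/

section Counting

/-- A list is the image of its index range under `getD`. -/
lemma map_getD_range (w : List ℕ) : (List.range w.length).map (fun x => w.getD x 0) = w := by
  apply List.ext_getElem
  · simp
  · intro n h₁ h₂
    simp [List.getElem?_eq_getElem h₂]

lemma countP_eq_countP_range (w : List ℕ) (q : ℕ → Bool) :
    w.countP q = (List.range w.length).countP (fun x => q (w.getD x 0)) := by
  conv_lhs => rw [← map_getD_range w]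
  rw [List.countP_map]
  rfl

lemma countP_lt_succ (w : List ℕ) (v : ℕ) :
    w.countP (fun x => decide (x < v + 1)) = w.countP (fun x => decide (x < v)) + w.count v := by
  induction w with
  | nil => simp
  | cons a w ih =>
    simp only [List.countP_cons, List.count_cons, ih, decide_eq_true_eq, beq_iff_eq]
    split_ifs <;> omega

lemma countP_lt_eq_sum (w : List ℕ) (v : ℕ) :
    w.countP (fun x => decide (x < v)) = ∑ x ∈ Finset.range v, w.count x := by
  induction v with
  | zero => simp
  | succ v ih => rw [countP_lt_succ, Finset.sum_range_succ, ih]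

lemma countP_lt_add_count_le (w : List ℕ) {u v : ℕ} (h : u < v) :
    w.countP (fun x => decide (x < u)) + w.count u ≤ w.countP (fun x => decide (x < v)) := by
  rw [← countP_lt_succ, countP_lt_eq_sum, countP_lt_eq_sum]
  exact Finset.sum_le_sum_of_subset (Finset.range_mono h)

/-- Exchanging the multiplicities of a repeated letter `t` and a simple letter `c` leaves no simple
letter with as many letters below it as `c` had. -/
lemma countP_lt_ne_of_count_swap {π w : List ℕ} {t c v : ℕ}
    (hw : ∀ x, w.count x = π.count (Equiv.swap t c x)) (hc : π.count c = 1)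
    (ht : 2 ≤ π.count t) (hv : w.count v = 1) :
    w.countP (fun x => decide (x < v)) ≠ π.countP (fun x => decide (x < c)) := by
  intro h
  have htc : t ≠ c := by rintro rfl; omega
  have hwc : w.count c = π.count t := by rw [hw, Equiv.swap_apply_right]
  -- Left case `t < c`: the `π.count t` copies of `t` below `c` become one. Right case `t > c`:
  -- nothing below `c` changes.
  have hsum : w.countP (fun x => decide (x < c)) + π.count t =
        π.countP (fun x => decide (x < c)) + 1 ∨
      w.countP (fun x => decide (x < c)) = π.countP (fun x => decide (x < c)) := by
    simp only [countP_lt_eq_sum]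
    by_cases hlt : t < c
    · left
      have hmem : t ∈ Finset.range c := Finset.mem_range.2 hlt
      rw [← Finset.add_sum_erase _ _ hmem, ← Finset.add_sum_erase _ (fun x => π.count x) hmem,
        hw t, Equiv.swap_apply_left, hc]
      have : ∑ x ∈ (Finset.range c).erase t, w.count x =
          ∑ x ∈ (Finset.range c).erase t, π.count x := by
        refine Finset.sum_congr rfl fun x hx => ?_
        rw [Finset.mem_erase, Finset.mem_range] at hx
        rw [hw, Equiv.swap_apply_of_ne_of_ne hx.1 hx.2.ne]
      omega
    · right
      refine Finset.sum_congr rfl fun x hx => ?_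
      rw [Finset.mem_range] at hx
      rw [hw, Equiv.swap_apply_of_ne_of_ne (by omega) (by omega)]
  -- Below `c` the number is too small, above `c` the copies of `c` make it too large, and `c`
  -- itself is now repeated.
  rcases lt_trichotomy v c with hvc | rfl | hvc
  · have := countP_lt_add_count_le w hvc
    omega
  · omega
  · have := countP_lt_add_count_le w hvc
    omega

end Counting

/-! ### Permutations of a multiset through letter counts -/

section Multisets

lemma count_multisetOf {n : ℕ} (k : Fin n → ℕ) (j : Fin n) :
    (multisetOf k).count (j.val + 1) = k j := by
  rw [multisetOf, Multiset.count_sum', Finset.sum_eq_single j]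
  · simp
  · intro b _ hb
    rw [Multiset.count_replicate, if_neg]
    intro h
    exact hb (Fin.ext (by omega))
  · simp

lemma mem_multisetOf {n : ℕ} {k : Fin n → ℕ} {x : ℕ} (h : x ∈ multisetOf k) : 1 ≤ x ∧ x ≤ n := by
  obtain ⟨j, -, hj⟩ := Multiset.mem_sum.1 h
  have := Multiset.eq_of_mem_replicate hj
  omega

lemma mem_multisetPerms_iff {n : ℕ} {k : Fin n → ℕ} {w : List ℕ} :
    w ∈ multisetPerms k ↔
      (∀ x ∈ w, 1 ≤ x ∧ x ≤ n) ∧ ∀ j : Fin n, w.count (j.val + 1) = k j := by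
  constructor
  · intro h
    have h' : (w : Multiset ℕ) = multisetOf k := h
    refine ⟨fun x hx => mem_multisetOf (h' ▸ Multiset.mem_coe.2 hx), fun j => ?_⟩
    rw [← count_multisetOf k j, ← h', Multiset.coe_count]
  · rintro ⟨hrange, hcount⟩
    change (w : Multiset ℕ) = multisetOf k
    ext x
    by_cases hx : 1 ≤ x ∧ x ≤ n
    · obtain ⟨j, rfl⟩ : ∃ j : Fin n, x = j.val + 1 := ⟨⟨x - 1, by omega⟩, by simp; omega⟩
      rw [count_multisetOf, Multiset.coe_count, hcount]
    · rw [Multiset.count_eq_zero.2 fun h => hx (hrange x (Multiset.mem_coe.1 h)),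
        Multiset.count_eq_zero.2 fun h => hx (mem_multisetOf h)]

lemma finite_multisetPerms {n : ℕ} (k : Fin n → ℕ) : (multisetPerms k).Finite := by
  obtain ⟨l, hl⟩ := Quotient.exists_rep (multisetOf k)
  refine (List.finite_toSet l.permutations).subset fun w hw => ?_
  have hw' : (w : Multiset ℕ) = multisetOf k := hw
  rw [← hl] at hw'
  exact List.mem_permutations.2 (Multiset.coe_eq_coe.1 hw')

end Multisets

/-! ### Overlapping occurrences -/

section Occurrences

lemma getD_drop_take {w : List ℕ} {a m x : ℕ} (hx : x < m) :
    ((w.drop a).take m).getD x 0 = w.getD (a + x) 0 := by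
  simp [hx]

/-- Two overlapping occurrences in a word of positive letters yield an extendable index. -/
lemma extendable_of_occursAt {p w : List ℕ} {a b : ℕ} (hw : ∀ x ∈ w, 1 ≤ x)
    (ha : OccursAt p w a) (hb : OccursAt p w b) (hab : a < b) (hba : b < a + p.length) :
    Extendable p (b - a + 1) := by
  have hlen := hb.1
  refine ⟨by omega, by omega, (w.drop a).take (p.length + (b - a)), ?_, ?_, ?_, ?_⟩
  · exact fun x hx => hw x (List.mem_of_mem_drop (List.mem_of_mem_take hx))
  · simp only [List.length_take, List.length_drop]; omega
  · refine ⟨by simp only [List.length_take, List.length_drop]; omega, fun j hj k hk => ?_⟩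
    rw [getD_drop_take (by omega), getD_drop_take (by omega), zero_add, zero_add]
    exact ha.2 j hj k hk
  · refine ⟨by simp only [List.length_take, List.length_drop]; omega, fun j hj k hk => ?_⟩
    rw [getD_drop_take (by omega), getD_drop_take (by omega),
      show a + (b - a + 1 - 1 + j) = b + j by omega, show a + (b - a + 1 - 1 + k) = b + k by omega]
    exact hb.2 j hj k hk

lemma mem_filter_occursAt {p w : List ℕ} {a : ℕ} :
    a ∈ (Finset.range (w.length + 1)).filter (OccursAt p w) ↔ OccursAt p w a := by
  rw [Finset.mem_filter, Finset.mem_range, and_iff_right_iff_imp]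
  intro h
  have := h.1
  omega

/-- With minimal overlap shift `d`, a word of length `p.length + d` has exactly two occurrences
of `p` iff they are its prefix and its suffix. -/
lemma occurrences_eq_two_iff {p w : List ℕ} {d : ℕ} (hd : 1 ≤ d) (hdp : d < p.length)
    (hmin : ∀ i, Extendable p i → d + 1 ≤ i) (hw : ∀ x ∈ w, 1 ≤ x)
    (hlen : w.length = p.length + d) :
    occurrences p w = 2 ↔ OccursAt p w 0 ∧ OccursAt p w d := by
  have key : ∀ a b, OccursAt p w a → OccursAt p w b → a < b → a = 0 ∧ b = d := by
    intro a b ha hb hab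
    have hlen' := hb.1
    -- Both positions lie in `[0, d]` and `d < ℓ`, so the occurrences overlap; minimality makes
    -- their distance at least `d`.
    have := hmin _ (extendable_of_occursAt hw ha hb hab (by omega))
    omega
  unfold occurrences
  rw [Finset.card_eq_two]
  constructor
  · rintro ⟨a, b, hne, heq⟩
    have ha : OccursAt p w a := mem_filter_occursAt.1 (by rw [heq]; simp)
    have hb : OccursAt p w b := mem_filter_occursAt.1 (by rw [heq]; simp)
    rcases lt_or_gt_of_ne hne with h | h
    · obtain ⟨rfl, rfl⟩ := key a b ha hb h
      exact ⟨ha, hb⟩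
    · obtain ⟨rfl, rfl⟩ := key b a hb ha h
      exact ⟨hb, ha⟩
  · rintro ⟨h₀, h₁⟩
    refine ⟨0, d, by omega, ?_⟩
    ext a
    rw [mem_filter_occursAt, Finset.mem_insert, Finset.mem_singleton]
    constructor
    · intro ha
      rcases Nat.eq_zero_or_pos a with h | h
      · exact Or.inl h
      · exact Or.inr (key 0 a h₀ ha h).2
    · rintro (rfl | rfl)
      · exact h₀
      · exact h₁

lemma getD_inj_of_nodup {p : List ℕ} (hp : p.Nodup) {j k : ℕ} (hj : j < p.length)
    (hk : k < p.length) : p.getD j 0 = p.getD k 0 ↔ j = k := by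
  rw [List.getD_eq_getElem _ _ hj, List.getD_eq_getElem _ _ hk, hp.getElem_inj_iff]

/-- The letter at the start of the second occurrence is simple. -/
lemma count_getD_eq_one {p w : List ℕ} {d : ℕ} (hp : p.Nodup) (hdp : d < p.length)
    (hlen : w.length = p.length + d) (h₀ : OccursAt p w 0) (h₁ : OccursAt p w d) :
    w.count (w.getD d 0) = 1 := by
  have h : ∀ x < w.length, (w.getD x 0 = w.getD d 0 ↔ x = d) := by
    intro x hx
    by_cases hxp : x < p.length
    · have := (h₀.2 x hxp d hdp).2
      rw [zero_add, zero_add, getD_inj_of_nodup hp hxp hdp] at this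
      exact this
    · have := (h₁.2 (x - d) (by omega) 0 (by omega)).2
      rw [add_zero, show d + (x - d) = x by omega,
        getD_inj_of_nodup hp (by omega) (by omega)] at this
      rw [this]
      omega
  rw [List.count, countP_eq_countP_range, ← List.count_eq_one_of_mem List.nodup_range
    (List.mem_range.2 (show d < w.length by omega)), List.count]
  refine List.countP_congr fun x hx => ?_
  rw [beq_iff_eq, beq_iff_eq]
  exact h x (List.mem_range.1 hx)

/-- The number of letters below the one at the start of the second occurrence depends only on the
pattern and the overlap. -/
lemma countP_lt_getD_eq {p w w' : List ℕ} {d : ℕ} (hdp : d < p.length)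
    (hlen : w.length = p.length + d) (hlen' : w'.length = p.length + d)
    (h₀ : OccursAt p w 0) (h₁ : OccursAt p w d) (h₀' : OccursAt p w' 0) (h₁' : OccursAt p w' d) :
    w.countP (fun x => decide (x < w.getD d 0)) =
      w'.countP (fun x => decide (x < w'.getD d 0)) := by
  rw [countP_eq_countP_range w, countP_eq_countP_range w', hlen, hlen']
  refine List.countP_congr fun x hx => ?_
  rw [List.mem_range] at hx
  rw [decide_eq_true_eq, decide_eq_true_eq]
  by_cases hxp : x < p.length
  · have h := (h₀.2 x hxp d hdp).1
    have h' := (h₀'.2 x hxp d hdp).1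
    rw [zero_add, zero_add] at h h'
    rw [h, h']
  · have h := (h₁.2 (x - d) (by omega) 0 (by omega)).1
    have h' := (h₁'.2 (x - d) (by omega) 0 (by omega)).1
    rw [add_zero, show d + (x - d) = x by omega] at h h'
    rw [h, h']

end Occurrences

/-- At the minimal extendable index, any extension with a repeated letter makes the property
"to have exactly two occurrences of `p`" unstable. -/
theorem propertyUnstable_of_extension_not_nodup {p : List ℕ} (hp : p.Nodup) {i : ℕ}
    (hi : IsLeast {i' : ℕ | Extendable p i'} i) {π : List ℕ} (hπ : π ∈ extensions p i)
    (hrep : ¬ π.Nodup) : PropertyUnstable (HasOccurrences p 2) := by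
  obtain ⟨d, rfl⟩ : ∃ d, i = d + 1 := ⟨i - 1, by have := hi.1.1; omega⟩
  have hd : 1 ≤ d := by have := hi.1.1; omega
  have hdp : d < p.length := hi.1.2.1
  have hmin : ∀ i', Extendable p i' → d + 1 ≤ i' := fun i' h => hi.2 h
  obtain ⟨hpos, hlen, h₀, h₁⟩ := hπ
  rw [Nat.add_sub_cancel] at hlen h₁
  set c := π.getD d 0 with hc_def
  have hc : π.count c = 1 := count_getD_eq_one hp hdp hlen h₀ h₁
  obtain ⟨t, ht⟩ : ∃ t, 2 ≤ π.count t := by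
    by_contra! h
    exact hrep (List.nodup_iff_count_le_one.2 fun a => Nat.le_of_lt_succ (h a))
  have hrange : ∀ x ∈ π, 1 ≤ x ∧ x ≤ π.sum := fun x hx => ⟨hpos x hx, List.le_sum_of_mem hx⟩
  obtain ⟨ht₁, ht₂⟩ := hrange t (List.count_pos_iff.1 (by omega))
  obtain ⟨hc₁, hc₂⟩ := hrange c (List.count_pos_iff.1 (by omega))
  -- The sum of `π` serves only as an upper bound for its letters.
  let k : Fin π.sum → ℕ := fun j => π.count (j.val + 1)
  let T : Fin π.sum := ⟨t - 1, by omega⟩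
  let C : Fin π.sum := ⟨c - 1, by omega⟩
  have hT : T.val + 1 = t := Nat.sub_add_cancel ht₁
  have hC : C.val + 1 = c := Nat.sub_add_cancel hc₁
  refine ⟨π.sum, k, fun hstable => ?_⟩
  have hπmem : π ∈ permsWith (HasOccurrences p 2) k :=
    ⟨mem_multisetPerms_iff.2 ⟨hrange, fun _ => rfl⟩,
      (occurrences_eq_two_iff hd hdp hmin hpos hlen).2 ⟨h₀, h₁⟩⟩
  have hfin : (permsWith (HasOccurrences p 2) k).Finite :=
    (finite_multisetPerms k).subset fun _ h => h.1
  have hcard := (Set.ncard_pos hfin).2 ⟨π, hπmem⟩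
  rw [hstable (Equiv.swap T C)] at hcard
  obtain ⟨w, hwk, hw2⟩ := Set.nonempty_of_ncard_ne_zero hcard.ne'
  obtain ⟨hwrange, hwk⟩ := mem_multisetPerms_iff.1 hwk
  have hcount : ∀ x, w.count x = π.count (Equiv.swap t c x) := by
    intro x
    by_cases hx : 1 ≤ x ∧ x ≤ π.sum
    · obtain ⟨j, rfl⟩ : ∃ j : Fin π.sum, x = j.val + 1 := ⟨⟨x - 1, by omega⟩, by simp; omega⟩
      rw [hwk, permuteMult, Equiv.swap_inv]
      change π.count ((Equiv.swap T C j).val + 1) = _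
      congr 1
      rw [Equiv.swap_apply_def, Equiv.swap_apply_def]
      simp only [Fin.ext_iff]
      split_ifs <;> omega
    · rw [Equiv.swap_apply_of_ne_of_ne (by rintro rfl; omega) (by rintro rfl; omega),
        List.count_eq_zero.2 fun h => hx (hwrange x h),
        List.count_eq_zero.2 fun h => hx (hrange x h)]
  -- Relabelling by the transposition shows that `w` is as long as `π`.
  have hperm : w.Perm (π.map (Equiv.swap t c)) := by
    refine List.perm_iff_count.2 fun x => ?_
    rw [hcount]
    conv_rhs => rw [← Equiv.swap_apply_self t c x]
    exact (List.count_map_of_injective _ _ (Equiv.injective _) _).symm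
  have hwlen : w.length = p.length + d := by rw [hperm.length_eq, List.length_map, hlen]
  obtain ⟨hw₀, hw₁⟩ := (occurrences_eq_two_iff hd hdp hmin (fun x hx => (hwrange x hx).1) hwlen).1 hw2
  exact countP_lt_ne_of_count_swap hcount hc ht (count_getD_eq_one hp hdp hwlen hw₀ hw₁)
    (countP_lt_getD_eq hdp hwlen hlen hw₀ hw₁ h₀ h₁)

end MultisetPattern

theorem mainTheorem3 (p : List ℕ) (hp : MultisetPattern.IsPattern p) (hnodup : p.Nodup)
    (i : ℕ) (hi : IsLeast {i' : ℕ | MultisetPattern.Extendable p i'} i)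
    (π : List ℕ) (hπ : MultisetPattern.IsExtendedPermutation p i π)
    (hrep : ¬ π.Nodup) :
    MultisetPattern.PropertyUnstable (MultisetPattern.HasOccurrences p 2) ∧
      MultisetPattern.PatternUnstable p := by
  have h := MultisetPattern.propertyUnstable_of_extension_not_nodup hnodup hi hπ.1 hrep
  refine ⟨h, ?_⟩
  obtain ⟨n, k, hk⟩ := h
  exact ⟨n, k, fun hstable => hk (hstable 2)⟩
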